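/- For $n\ge 1$ let $\mathfrak S_n(1342,2431)$ be the set of permutations $\pi=\pi(1)\cdots\pi(n)$ of $\{1,\dots,n\}$ that avoid both of the patterns $1342$ and $2431$ (no subsequence of $\pi(1)\cdots\pi(n)$ is order isomorphic to $1342$ or to $2431$), let $\mathsf{des}\,\pi=\#\{1\le i\le n-1:\pi(i)>\pi(i+1)\}$ be the number of descents of $\pi$, and let $$Y_n(t)=\sum_{\pi\in\mathfrak S_n(1342,2431)}t^{\mathsf{des}\,\pi}.$$ For $m\ge 0$ let $u_m$ be the number of permutations $\pi\in\mathfrak S_{2m+1}(1342,2431)$ that are alternating (up-down), i.e. satisfy $\pi(1)<\pi(2)>\pi(3)<\cdots>\pi(2m+1)$. Theorem. For every $n\ge 1$, $$Y_n(-1)=\sum_{\pi\in\mathfrak S_n(1342,2431)}(-1)^{\mathsf{des}\,\pi}=\begin{cases}0 & \text{if } n \text{ is even},\\ (-1)^{\frac{n-1}{2}}\,u_{\frac{n-1}{2}} & \text{if } n \text{ is odd}.\end{cases}$$ -/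

import Mathlib

open Finset

namespace PatternAvoidance

/-- The permutation `π`, read as the word `π(1) π(2) ⋯ π(n)`, contains the pattern `σ`: some
subsequence of `π` is order isomorphic to the word of `σ`. Positions and values are shifted
to start at `0`. -/
def Contains {k n : ℕ} (σ : Equiv.Perm (Fin k)) (π : Equiv.Perm (Fin n)) : Prop :=
  ∃ f : Fin k → Fin n, StrictMono f ∧ ∀ i j : Fin k, σ i < σ j ↔ π (f i) < π (f j)

instance decidableContains {k n : ℕ} (σ : Equiv.Perm (Fin k)) (π : Equiv.Perm (Fin n)) :
    Decidable (Contains σ π) :=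
  inferInstanceAs (Decidable (∃ f : Fin k → Fin n, (∀ i j : Fin k, i < j → f i < f j) ∧
    ∀ i j : Fin k, σ i < σ j ↔ π (f i) < π (f j)))

/-- The permutations of length `n` that avoid both patterns `σ` and `τ`. -/
def avoiders (n : ℕ) {k l : ℕ} (σ : Equiv.Perm (Fin k)) (τ : Equiv.Perm (Fin l)) :
    Finset (Equiv.Perm (Fin n)) :=
  {π | ¬ Contains σ π ∧ ¬ Contains τ π}

/-- The number of descents, i.e. of positions `i` (with `i + 1` a position) such that
`π(i) > π(i + 1)`. -/
def des {n : ℕ} (π : Equiv.Perm (Fin n)) : ℕ :=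
  #{i : Fin n | ∃ h : (i : ℕ) + 1 < n, π ⟨i + 1, h⟩ < π i}

/-- Alternating (up-down) permutations: `π(1) < π(2) > π(3) < π(4) > ⋯`. As positions start at
`0` here, there is an ascent at every even position and a descent at every odd one. -/
def IsAlternating {n : ℕ} (π : Equiv.Perm (Fin n)) : Prop :=
  ∀ (i : Fin n) (h : (i : ℕ) + 1 < n),
    (Even (i : ℕ) → π i < π ⟨i + 1, h⟩) ∧ (Odd (i : ℕ) → π ⟨i + 1, h⟩ < π i)

instance decidableIsAlternating {n : ℕ} (π : Equiv.Perm (Fin n)) : Decidable (IsAlternating π) :=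
  inferInstanceAs (Decidable (∀ (i : Fin n) (h : (i : ℕ) + 1 < n),
    (Even (i : ℕ) → π i < π ⟨i + 1, h⟩) ∧ (Odd (i : ℕ) → π ⟨i + 1, h⟩ < π i)))

/-- The alternating permutations of length `n` that avoid both patterns `σ` and `τ`. -/
def alternatingAvoiders (n : ℕ) {k l : ℕ} (σ : Equiv.Perm (Fin k)) (τ : Equiv.Perm (Fin l)) :
    Finset (Equiv.Perm (Fin n)) :=
  {π ∈ avoiders n σ τ | IsAlternating π}

/-- The pattern `1342`. -/
def p1342 : Equiv.Perm (Fin 4) where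
  toFun := ![0, 2, 3, 1]
  invFun := ![0, 3, 1, 2]
  left_inv := by decide
  right_inv := by decide

/-- The pattern `2431`. -/
def p2431 : Equiv.Perm (Fin 4) where
  toFun := ![1, 3, 2, 0]
  invFun := ![3, 0, 2, 1]
  left_inv := by decide
  right_inv := by decide

/-- The descent polynomial `Y_n(t) = ∑ t ^ des π` over the `(1342, 2431)`-avoiding permutations
of length `n`. -/
noncomputable def Y (n : ℕ) : Polynomial ℤ :=
  ∑ π ∈ avoiders n p1342 p2431, Polynomial.X ^ des π

/-- `u_n` is the number of `(1342, 2431)`-avoiding alternating permutations of length `2n + 1`. -/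
def u (n : ℕ) : ℕ :=
  #(alternatingAvoiders (2 * n + 1) p1342 p2431)

end PatternAvoidance

/-! Give every letter a weight according to its type: valley, peak, double ascent or double descent,
where a missing neighbour counts as larger. The weight of a word is the product over its letters.
The core (`sums_congr`) is that the total weight of the avoiders depends only on the weight of a
valley, the weight of a peak and the sum of the two double weights.

Two choices of weights then give the theorem. Weighting each letter followed by a smaller one by -1
yields `(-1) ^ des`; here valleys weigh 1, peaks -1, and the double weights 1 and -1 cancel. Setting
both double weights to 0 leaves only words without double letters. By the convention at the ends
these begin and end with a valley, so they are exactly the up-down words of odd length, each with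
sign -1 to the number of peaks.

Invariance is proved by recursion on the largest letter `m`. At either end of the word, `m` is a
double letter and takes part in no pattern, so the two ends contribute the sum of the double weights
times the same total. Otherwise `m` is interior, and since 2431 is 1342 reversed, reversal reduces
to the case where the second largest letter `m'` precedes `m`. Such a word is `a m' r` with `a`
avoiding 132 and lying above all of `r` except `m` (`avoidsBoth_append_second_max`). Whenever `m'`
is a double letter here, adding the mirror images again produces the sum of the double weights. The
factor from `a` is handled by the analogous statement for 132 (`sum132_congr`). -/

namespace PatternAvoidance

/-! ### Words, their weights and pattern avoidance -/

/-- The weight of a word: the product of the weights of its letters, where the weight of a letter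
depends on whether its left neighbour is smaller and on whether its right neighbour is smaller.
A missing neighbour counts as larger; `b` tells whether the left neighbour of the first letter
is smaller. -/
def wordWeight (c : Bool → Bool → ℤ) : Bool → List ℕ → ℤ
  | _, [] => 1
  | b, [_] => c b false
  | b, x :: y :: l => c b (decide (y < x)) * wordWeight c (decide (x < y)) (y :: l)

/-- The word has no subsequence that is order isomorphic to `132`. -/
def Avoids132 (l : List ℕ) : Prop :=
  ∀ x y z, [x, y, z].Sublist l → ¬ (x < z ∧ z < y)

/-- The word has no subsequence that is order isomorphic to `1342` or to `2431`. -/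
def AvoidsBoth (l : List ℕ) : Prop :=
  ∀ x y z t, [x, y, z, t].Sublist l → ¬ (x < t ∧ t < y ∧ y < z) ∧ ¬ (t < x ∧ x < z ∧ z < y)

/-- The words in which every element of `S` occurs exactly once. -/
def words (S : Finset ℕ) : Finset (List ℕ) :=
  ⟨S.val.lists, Multiset.lists_nodup_finset S⟩

theorem mem_words {S : Finset ℕ} {l : List ℕ} :
    l ∈ words S ↔ l.Nodup ∧ ∀ y, y ∈ l ↔ y ∈ S := by
  rw [words, Finset.mem_mk, Multiset.mem_lists_iff]
  constructor
  · intro h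
    have h' : S.val = (l : Multiset ℕ) := h
    constructor
    · rw [← Multiset.coe_nodup, ← h']
      exact S.nodup
    · intro y
      rw [← Multiset.mem_coe, ← h', Finset.mem_val]
  · rintro ⟨h1, h2⟩
    have : S.val = (l : Multiset ℕ) := by
      rw [Multiset.Nodup.ext S.nodup (Multiset.coe_nodup.2 h1)]
      intro y
      simp [h2 y]
    exact this

theorem words_empty : words ∅ = {[]} := by
  ext l
  simp only [mem_words, Finset.notMem_empty, iff_false, Finset.mem_singleton]
  constructor
  · rintro ⟨-, h⟩
    exact List.eq_nil_iff_forall_not_mem.2 h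
  · rintro rfl
    simp

theorem sum_words_reverse (S : Finset ℕ) (f : List ℕ → ℤ) :
    ∑ l ∈ words S, f l.reverse = ∑ l ∈ words S, f l := by
  refine Finset.sum_nbij' List.reverse List.reverse ?_ ?_ ?_ ?_ ?_ <;>
    simp +contextual [mem_words]

/-- Cut each word at `x`; `U` is the set of letters before the cut. The recursions at the largest
and second largest letter both start from this. -/
theorem sum_words_pivot {S : Finset ℕ} {x : ℕ} (hx : x ∈ S) (f : List ℕ → ℤ) :
    ∑ l ∈ words S, f l = ∑ U ∈ (S.erase x).powerset, ∑ a ∈ words U,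
      ∑ r ∈ words (S.erase x \ U), f (a ++ x :: r) := by
  symm
  simp only [Finset.sum_sigma']
  refine Finset.sum_nbij (fun p => p.2.1 ++ x :: p.2.2) ?_ ?_ ?_ ?_
  · rintro ⟨U, a, r⟩ h
    simp only [Finset.mem_sigma, Finset.mem_powerset, mem_words, Finset.mem_sdiff,
      Finset.mem_erase, Finset.subset_iff] at h ⊢
    obtain ⟨hU, ⟨ha, ha'⟩, hr, hr'⟩ := h
    rw [List.nodup_append', List.nodup_cons]
    constructor
    · refine ⟨ha, ⟨?_, hr⟩, ?_⟩
      · grind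
      · intro y hy hy'
        grind
    · intro y
      grind
  · rintro ⟨U, a, r⟩ h ⟨U', a', r'⟩ h' heq
    simp only [Finset.mem_coe, Finset.mem_sigma, Finset.mem_powerset, mem_words, Finset.mem_sdiff,
      Finset.mem_erase, Finset.subset_iff] at h h' heq
    have hxa : x ∉ a := by grind
    have hxr : x ∉ a' := by grind
    have hxr2 : x ∉ r := by grind
    have hxr3 : x ∉ r' := by grind
    have key := List.append_eq_append_iff.1 heq
    have h3 : a = a' ∧ r = r' := by
      rcases key with ⟨as, h1, h2⟩ | ⟨as, h1, h2⟩ <;> cases as <;> grind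
    obtain ⟨rfl, rfl⟩ := h3
    have : U = U' := by
      ext y
      rw [← h.2.1.2, ← h'.2.1.2]
    subst this
    rfl
  · intro l hl
    simp only [Finset.mem_coe, mem_words] at hl
    obtain ⟨a, r, rfl⟩ := List.append_of_mem ((hl.2 x).2 hx)
    have hn := hl.1
    rw [List.nodup_append', List.nodup_cons] at hn
    refine ⟨⟨a.toFinset, a, r⟩, ?_, rfl⟩
    simp only [Finset.mem_coe, Finset.mem_sigma, Finset.mem_powerset, mem_words, Finset.mem_sdiff,
      Finset.mem_erase, Finset.subset_iff, List.mem_toFinset]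
    have h2 := hl.2
    have h3 := hn.2.2
    simp only [List.disjoint_cons_right] at h3
    refine ⟨?_, ⟨hn.1, ?_⟩, hn.2.1.2, ?_⟩
    · grind
    · simp
    · intro y
      have := h2 y
      have h4 := @h3.2 y
      grind
  · intros; rfl

theorem sum_words_head {S : Finset ℕ} {x : ℕ} (hx : x ∈ S) (f : List ℕ → ℤ) :
    (∑ l ∈ words S, if l.head? = some x then f l else 0) =
      ∑ r ∈ words (S.erase x), f (x :: r) := by
  rw [← Finset.sum_filter]
  symm
  refine Finset.sum_nbij (fun r => x :: r) ?_ ?_ ?_ ?_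
  · intro r hr
    simp only [Finset.mem_filter, mem_words, List.nodup_cons, List.mem_cons, List.head?_cons,
      Finset.mem_erase] at hr ⊢
    grind
  · intro r _ r' _ h
    simpa using h
  · intro l hl
    simp only [Finset.coe_filter, Set.mem_ofPred_eq, mem_words] at hl
    obtain ⟨⟨h1, h2⟩, h3⟩ := hl
    cases l with
    | nil => simp at h3
    | cons y r =>
      simp only [List.head?_cons, Option.some.injEq] at h3
      subst h3
      refine ⟨r, ?_, rfl⟩
      simp only [Finset.mem_coe, mem_words, Finset.mem_erase]
      grind
  · intros; rfl

/-! ### Behaviour of weights under cutting and reversal -/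

section wordWeight

variable (c : Bool → Bool → ℤ)

theorem wordWeight_cons (b : Bool) (m : ℕ) (t : List ℕ) (ht : ∀ y ∈ t, y < m) :
    wordWeight c b (m :: t) = c b (decide (t ≠ [])) * wordWeight c false t := by
  cases t with
  | nil => simp [wordWeight]
  | cons y t =>
    have := ht y (by simp)
    have h2 : ¬ m < y := by omega
    simp [wordWeight, this, h2]

theorem wordWeight_append (b : Bool) (s t : List ℕ) (m : ℕ) (hs : ∀ y ∈ s, y < m)
    (ht : ∀ y ∈ t, y < m) :
    wordWeight c b (s ++ m :: t) =
      (if s = [] then c b (decide (t ≠ [])) else c true (decide (t ≠ []))) * wordWeight c b s *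
        wordWeight c false t := by
  induction s generalizing b with
  | nil => simp [wordWeight_cons c b m t ht, wordWeight]
  | cons x s ih =>
    cases s with
    | nil =>
      have := hs x (by simp)
      have h2 : ¬ m < x := by omega
      simp only [List.cons_append, List.nil_append, wordWeight]
      rw [wordWeight_cons c _ m t ht]
      simp [this, h2]
      ring
    | cons y s =>
      have := ih (decide (x < y)) (fun z hz => hs z (by simp at hz ⊢; tauto))
      simp only [List.cons_append, wordWeight] at this ⊢
      rw [this]
      simp
      ring

/-- The neighbour `m` is larger, and so is a missing neighbour by convention. Hence each side weighs
the same inside the word as on its own. -/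
theorem wordWeight_max (s t : List ℕ) (m : ℕ) (hs : ∀ y ∈ s, y < m) (ht : ∀ y ∈ t, y < m) :
    wordWeight c false (s ++ m :: t) =
      c (decide (s ≠ [])) (decide (t ≠ [])) * wordWeight c false s * wordWeight c false t := by
  rw [wordWeight_append c false s t m hs ht]
  by_cases h : s = [] <;> simp [h]

theorem exists_max_split {l : List ℕ} (hl : l.Nodup) (h0 : l ≠ []) :
    ∃ s m t, l = s ++ m :: t ∧ (∀ y ∈ s, y < m) ∧ ∀ y ∈ t, y < m := by
  have hne : l.toFinset.Nonempty := by simpa using h0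
  have hm := Finset.max'_mem _ hne
  obtain ⟨s, t, h⟩ := List.append_of_mem (List.mem_toFinset.1 hm)
  set m := l.toFinset.max' hne with hmdef
  have hle : ∀ y ∈ l, y ≤ m := fun y hy => Finset.le_max' _ _ (List.mem_toFinset.2 hy)
  refine ⟨s, m, t, h, ?_, ?_⟩
  · intro y hy
    have h1 := hle y (by rw [h]; simp [hy])
    have : y ≠ m := by
      rintro rfl
      rw [h, List.nodup_append'] at hl
      exact hl.2.2 hy (by simp)
    omega
  · intro y hy
    have h1 := hle y (by rw [h]; simp [hy])
    have : y ≠ m := by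
      rintro rfl
      rw [h, List.nodup_append', List.nodup_cons] at hl
      exact hl.2.1.1 hy
    omega

/-- The recursive definition reads from the left and hides the symmetry; cutting at the maximum is
symmetric, so the induction goes that way. -/
theorem wordWeight_reverse (l : List ℕ) (hl : l.Nodup) :
    wordWeight c false l.reverse = wordWeight (fun a b => c b a) false l := by
  induction h : l.length using Nat.strong_induction_on generalizing l with
  | _ n ih =>
    by_cases h0 : l = []
    · simp [h0, wordWeight]
    obtain ⟨s, m, t, rfl, hs, ht⟩ := exists_max_split hl h0
    have hn := hl
    rw [List.nodup_append', List.nodup_cons] at hn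
    simp only [List.length_append, List.length_cons] at h
    have e : (s ++ m :: t).reverse = t.reverse ++ m :: s.reverse := by simp
    rw [e, wordWeight_max _ _ _ _ (by simpa using ht) (by simpa using hs),
      wordWeight_max _ _ _ _ hs ht, ih s.length (by omega) s hn.1 rfl,
      ih t.length (by omega) t hn.2.1.2 rfl]
    simp
    ring

end wordWeight

/-! ### Structure of the avoiding words -/

section Avoidance

theorem Avoids132.of_sublist {l l' : List ℕ} (h : Avoids132 l') (hs : l.Sublist l') :
    Avoids132 l :=
  fun x y z h' => h x y z (h'.trans hs)

theorem AvoidsBoth.of_sublist {l l' : List ℕ} (h : AvoidsBoth l') (hs : l.Sublist l') :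
    AvoidsBoth l :=
  fun x y z t h' => h x y z t (h'.trans hs)

theorem avoidsBoth_reverse {l : List ℕ} : AvoidsBoth l.reverse ↔ AvoidsBoth l := by
  have key : ∀ l : List ℕ, AvoidsBoth l → AvoidsBoth l.reverse := by
    intro l h x y z t hs
    have h1 := h t z y x (by simpa using hs.reverse)
    exact ⟨fun h2 => h1.2 (by omega), fun h2 => h1.1 (by omega)⟩
  exact ⟨fun h => by simpa using key _ h, key l⟩

theorem avoids132_nil : Avoids132 [] := by
  intro x y z h
  simp at h

theorem sublist_append_triple {x y z : ℕ} {s t : List ℕ} (h : [x, y, z].Sublist (s ++ t)) :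
    [x, y, z].Sublist t ∨ (x ∈ s ∧ [y, z].Sublist t) ∨ ([x, y].Sublist s ∧ z ∈ t) ∨
      [x, y, z].Sublist s := by
  obtain ⟨l₁, l₂, e, h1, h2⟩ := List.sublist_append_iff.1 h
  rcases l₁ with _ | ⟨a, _ | ⟨b, _ | ⟨d, _ | ⟨f, l⟩⟩⟩⟩ <;> simp at e <;>
    (try obtain ⟨rfl, rfl, rfl⟩ := e) <;> simp_all

theorem sublist_append_quadruple {x y z w : ℕ} {s t : List ℕ}
    (h : [x, y, z, w].Sublist (s ++ t)) :
    [x, y, z, w].Sublist t ∨ (x ∈ s ∧ [y, z, w].Sublist t) ∨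
      ([x, y].Sublist s ∧ [z, w].Sublist t) ∨ ([x, y, z].Sublist s ∧ w ∈ t) ∨
      [x, y, z, w].Sublist s := by
  obtain ⟨l₁, l₂, e, h1, h2⟩ := List.sublist_append_iff.1 h
  rcases l₁ with _ | ⟨a, _ | ⟨b, _ | ⟨d, _ | ⟨f, _ | ⟨g, l⟩⟩⟩⟩⟩ <;> simp at e <;>
    (try obtain ⟨rfl, rfl, rfl, rfl⟩ := e) <;> simp_all

/-- A letter before `m` and a larger one after it would form 132 with `m`; conversely, a 132
straddling the cut needs its 1 on the left below its 2 on the right. -/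
theorem avoids132_append_max {s t : List ℕ} {m : ℕ} (hn : (s ++ m :: t).Nodup)
    (hs : ∀ y ∈ s, y < m) (ht : ∀ y ∈ t, y < m) :
    Avoids132 (s ++ m :: t) ↔ (∀ u ∈ s, ∀ x ∈ t, x < u) ∧ Avoids132 s ∧ Avoids132 t := by
  constructor
  · intro h
    refine ⟨fun u hu x hx => ?_, h.of_sublist (by simp),
      h.of_sublist ((List.sublist_cons_self _ _).trans (List.sublist_append_right _ _))⟩
    have h1 := h u m x ((List.singleton_sublist.2 hu).append
      ((List.singleton_sublist.2 hx).cons_cons m))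
    have h2 : u ≠ x := by
      rintro rfl
      rw [List.nodup_append'] at hn
      exact hn.2.2 hu (by simp [hx])
    have := ht x hx
    omega
  · rintro ⟨h, hs', ht'⟩ x y z hxyz ⟨h1, h2⟩
    rcases sublist_append_triple hxyz with h3 | ⟨h3, h4⟩ | ⟨h3, h4⟩ | h3
    · rcases List.sublist_cons_iff.1 h3 with h4 | ⟨r, h4, h5⟩
      · exact ht' x y z h4 ⟨h1, h2⟩
      · simp only [List.cons.injEq] at h4
        obtain ⟨rfl, rfl⟩ := h4
        have := ht y (h5.subset (by simp))
        omega
    · have hz : z ∈ t := by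
        rcases List.sublist_cons_iff.1 h4 with h4 | ⟨r, h4, h5⟩
        · exact h4.subset (by simp)
        · simp only [List.cons.injEq] at h4
          obtain ⟨rfl, rfl⟩ := h4
          exact h5.subset (by simp)
      have := h x h3 z hz
      omega
    · have hx := h3.subset (show x ∈ [x, y] by simp)
      have hy := hs y (h3.subset (show y ∈ [x, y] by simp))
      rcases List.mem_cons.1 h4 with rfl | h4
      · omega
      · have := h x hx z h4
        omega
    · exact hs' x y z h3 ⟨h1, h2⟩

theorem avoidsBoth_cons_max {t : List ℕ} {m : ℕ} (ht : ∀ y ∈ t, y < m) :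
    AvoidsBoth (m :: t) ↔ AvoidsBoth t := by
  constructor
  · exact fun h => h.of_sublist (List.sublist_cons_self _ _)
  · intro h x y z w hs
    rcases List.sublist_cons_iff.1 hs with h4 | ⟨r, h4, h5⟩
    · exact h x y z w h4
    · simp only [List.cons.injEq] at h4
      obtain ⟨rfl, rfl⟩ := h4
      have := ht y (h5.subset (by simp))
      have := ht z (h5.subset (by simp))
      omega

/-- The words `a m' r`, where `m'` is the second largest letter, and where `r` contains the
largest letter `m` and does not end with it. -/
theorem avoidsBoth_append_second_max {a r : List ℕ} {m m' : ℕ} (hn : (a ++ m' :: r).Nodup)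
    (hm : m' < m) (hmr : m ∈ r) (hlast : r.getLast? ≠ some m) (ha : ∀ y ∈ a, y < m')
    (hr : ∀ y ∈ r, y ≠ m → y < m') :
    AvoidsBoth (a ++ m' :: r) ↔
      (∀ u ∈ a, ∀ x ∈ r, x ≠ m → x < u) ∧ Avoids132 a ∧ AvoidsBoth r := by
  have hn' := hn
  rw [List.nodup_append', List.nodup_cons] at hn'
  obtain ⟨-, ⟨hm'r, hnr⟩, hdisj⟩ := hn'
  constructor
  · intro h
    obtain ⟨b, t, rfl⟩ := List.append_of_mem hmr
    have ht : t ≠ [] := by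
      rintro rfl
      simp at hlast
    have hnt := hnr
    rw [List.nodup_append', List.nodup_cons] at hnt
    have htu : ∀ u ∈ a, ∀ x ∈ t, x < u := by
      intro u hu x hx
      -- If `u < x`, then `u m' m x` is a 1342.
      have h1 := h u m' m x ((List.singleton_sublist.2 hu).append
        (List.Sublist.cons_cons m' ((List.nil_sublist b).append
          ((List.singleton_sublist.2 hx).cons_cons m))))
      have h2 : u ≠ x := by
        rintro rfl
        exact hdisj hu (by simp [hx])
      have h3 : x ≠ m := by
        rintro rfl
        exact hnt.2.1.1 hx
      have := hr x (by simp [hx]) h3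
      omega
    -- As `m` is not last, some `x` follows it. Being below all of `a`, it can serve as the final 1
    -- of a 2431: in `u m' y x` if some `y` before `m` exceeds `u`, and below after any 132 inside
    -- `a`.
    obtain ⟨x, hx⟩ := List.exists_mem_of_ne_nil t ht
    refine ⟨?_, ?_, h.of_sublist ((List.sublist_cons_self _ _).trans
      (List.sublist_append_right _ _))⟩
    · intro u hu y hy hym
      have hxu := htu u hu x hx
      rcases List.mem_append.1 hy with hyb | hyt
      · have h1 := h u m' y x ((List.singleton_sublist.2 hu).append
          (List.Sublist.cons_cons m' ((List.singleton_sublist.2 hyb).append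
            ((List.singleton_sublist.2 hx).cons m))))
        have h2 : u ≠ y := by
          rintro rfl
          exact hdisj hu (by simp [hyb])
        have := hr y hy hym
        omega
      · rcases List.mem_cons.1 hyt with rfl | hyt
        · exact absurd rfl hym
        · exact htu u hu y hyt
    · intro u v w huvw h1
      have h2 := h u v w x (huvw.append (List.singleton_sublist.2 (by simp [hx])))
      have := htu u (huvw.subset (by simp)) x hx
      omega
  · rintro ⟨h, ha', hr'⟩
    -- Only `m` can rise above a letter on the left of the cut. This rules out every straddling
    -- occurrence except a 2431 whose last letter alone is in `r`; that one would put a 132 into `a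
    -- m'`.
    have hX : ∀ u ∈ a ++ [m'], ∀ x ∈ r, u < x → x = m := by
      intro u hu x hx hux
      by_contra hxm
      rcases List.mem_append.1 hu with hu | hu
      · have := h u hu x hx hxm
        omega
      · have := hr x hx hxm
        simp only [List.mem_singleton] at hu
        omega
    have hXm : ∀ u ∈ a ++ [m'], u < m := by
      intro u hu
      rcases List.mem_append.1 hu with hu | hu
      · have := ha u hu
        omega
      · simp only [List.mem_singleton] at hu
        omega
    have hna : (a ++ [m']).Nodup := by
      refine hn.sublist ?_
      rw [show a ++ m' :: r = (a ++ [m']) ++ r by simp]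
      exact List.sublist_append_left _ _
    have hX132 : Avoids132 (a ++ [m']) := by
      rw [avoids132_append_max hna ha (by simp)]
      exact ⟨by simp, ha', avoids132_nil⟩
    intro x y z w hs
    rw [show a ++ m' :: r = (a ++ [m']) ++ r by simp] at hs
    rcases sublist_append_quadruple hs with hs | ⟨h1, h2⟩ | ⟨h1, h2⟩ | ⟨h1, h2⟩ | h1
    · exact hr' x y z w hs
    · have hy := hX x h1 y (h2.subset (by simp))
      have hz := hX x h1 z (h2.subset (by simp))
      have hw := hX x h1 w (h2.subset (by simp))
      omega
    · have hx := h1.subset (show x ∈ [x, y] by simp)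
      have hy := hXm y (h1.subset (by simp))
      have hz := hX x hx z (h2.subset (by simp))
      have hw := hX x hx w (h2.subset (by simp))
      omega
    · have hx := h1.subset (show x ∈ [x, y, z] by simp)
      have hy := hXm y (h1.subset (by simp))
      have hw := hX x hx w h2
      have := hX132 x y z h1
      omega
    · have h2 := hX132 x y w (List.Sublist.trans (by simp) h1)
      have h3 := hX132 x y z (List.Sublist.trans (by simp) h1)
      omega

end Avoidance

/-! ### Weighted sums, their recursions and their invariance -/

section WeightedSums

open Classical in
/-- The weighted sum of the `132`-avoiding words on `S`. -/
noncomputable def sum132 (c : Bool → Bool → ℤ) (S : Finset ℕ) : ℤ :=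
  ∑ l ∈ words S, if Avoids132 l then wordWeight c false l else 0

open Classical in
/-- The weighted sum of the `(1342, 2431)`-avoiding words on `S`. -/
noncomputable def sumBoth (c : Bool → Bool → ℤ) (S : Finset ℕ) : ℤ :=
  ∑ l ∈ words S, if AvoidsBoth l then wordWeight c false l else 0

open Classical in
/-- The part of `sumBoth` of the words that neither begin nor end with `m`. -/
noncomputable def sumInner (c : Bool → Bool → ℤ) (m : ℕ) (S : Finset ℕ) : ℤ :=
  ∑ l ∈ words S, if AvoidsBoth l ∧ l.head? ≠ some m ∧ l.getLast? ≠ some m then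
    wordWeight c false l else 0

open Classical in
/-- The part of `sumInner` of the words in which `m'` precedes `m`. -/
noncomputable def sumLeft (c : Bool → Bool → ℤ) (m m' : ℕ) (S : Finset ℕ) : ℤ :=
  ∑ l ∈ words S, if AvoidsBoth l ∧ l.getLast? ≠ some m ∧ [m', m].Sublist l then
    wordWeight c false l else 0

variable (c : Bool → Bool → ℤ)

theorem decide_ne_nil_of_mem_words {S : Finset ℕ} {l : List ℕ} (hl : l ∈ words S) :
    decide (l ≠ []) = decide S.Nonempty := by
  rw [mem_words] at hl
  congr 1
  rw [eq_iff_iff]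
  constructor
  · intro h
    obtain ⟨y, hy⟩ := List.exists_mem_of_ne_nil l h
    exact ⟨y, (hl.2 y).1 hy⟩
  · rintro ⟨y, hy⟩
    exact List.ne_nil_of_mem ((hl.2 y).2 hy)

theorem nodup_append_of_mem_words {S U : Finset ℕ} {x : ℕ} {a r : List ℕ}
    (ha : a ∈ words U) (hU : U ⊆ S.erase x) (hr : r ∈ words (S.erase x \ U)) :
    (a ++ x :: r).Nodup := by
  simp only [mem_words, Finset.subset_iff, Finset.mem_sdiff, Finset.mem_erase] at ha hU hr
  rw [List.nodup_append', List.nodup_cons]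
  refine ⟨ha.1, ⟨by grind, hr.1⟩, ?_⟩
  intro y hy hy'
  grind

theorem sum132_empty : sum132 c ∅ = 1 := by
  simp [sum132, words_empty, avoids132_nil, wordWeight]

theorem sum132_eq {S : Finset ℕ} {m : ℕ} (hm : m ∈ S) (hmax : ∀ y ∈ S, y ≤ m) :
    sum132 c S = ∑ U ∈ (S.erase m).powerset,
      if ∀ u ∈ U, ∀ x ∈ S.erase m \ U, x < u then
        c (decide U.Nonempty) (decide (S.erase m \ U).Nonempty) * sum132 c U *
          sum132 c (S.erase m \ U) else 0 := by
  rw [sum132, sum_words_pivot hm]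
  refine Finset.sum_congr rfl fun U hU => ?_
  rw [Finset.mem_powerset] at hU
  have key : ∀ a ∈ words U, ∀ r ∈ words (S.erase m \ U),
      ((Avoids132 (a ++ m :: r) ↔
        (∀ u ∈ U, ∀ x ∈ S.erase m \ U, x < u) ∧ Avoids132 a ∧ Avoids132 r) ∧
      wordWeight c false (a ++ m :: r) =
        c (decide U.Nonempty) (decide (S.erase m \ U).Nonempty) * wordWeight c false a *
          wordWeight c false r) := by
    intro a ha r hr
    have hn := nodup_append_of_mem_words ha hU hr
    have hda := decide_ne_nil_of_mem_words ha
    have hdr := decide_ne_nil_of_mem_words hr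
    have hlt : ∀ y ∈ S.erase m, y < m := by
      intro y hy
      rw [Finset.mem_erase] at hy
      exact lt_of_le_of_ne (hmax y hy.2) hy.1
    rw [mem_words] at ha hr
    have h1 : ∀ y ∈ a, y < m := fun y hy => hlt y (hU ((ha.2 y).1 hy))
    have h2 : ∀ y ∈ r, y < m := fun y hy => hlt y (Finset.sdiff_subset ((hr.2 y).1 hy))
    constructor
    · rw [avoids132_append_max hn h1 h2]
      simp only [ha.2, hr.2]
    · rw [wordWeight_max c a r m h1 h2, hda, hdr]
  split_ifs with h
  · rw [sum132, sum132, mul_assoc, Finset.sum_mul_sum, Finset.mul_sum]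
    refine Finset.sum_congr rfl fun a ha => ?_
    rw [Finset.mul_sum]
    refine Finset.sum_congr rfl fun r hr => ?_
    rw [(key a ha r hr).2]
    have hiff := (key a ha r hr).1
    rw [and_iff_right h] at hiff
    rw [hiff]
    by_cases h1 : Avoids132 a <;> by_cases h2 : Avoids132 r <;> simp [h1, h2, mul_assoc]
  · refine Finset.sum_eq_zero fun a ha => Finset.sum_eq_zero fun r hr => ?_
    rw [if_neg]
    rw [(key a ha r hr).1]
    tauto

/-- The two systems of letter weights agree on valleys and peaks, and on the sum of the weights
of a double ascent and a double descent. -/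
def SameTotals (c c' : Bool → Bool → ℤ) : Prop :=
  c false false = c' false false ∧ c true true = c' true true ∧
    c false true + c true false = c' false true + c' true false

theorem SameTotals.swap (c : Bool → Bool → ℤ) : SameTotals c (fun a b => c b a) :=
  ⟨rfl, rfl, add_comm _ _⟩

/-- Separates the two cuts that place the maximum first or last. -/
theorem sum_powerset_eq {T : Finset ℕ} (hT : T.Nonempty) (g : Finset ℕ → ℤ) :
    ∑ U ∈ T.powerset, g U = g ∅ + g T + ∑ U ∈ (T.powerset.erase ∅).erase T, g U := by
  rw [add_assoc, Finset.add_sum_erase _ _ (by simp [hT.ne_empty]),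
    Finset.add_sum_erase _ _ (by simp)]

/-- With other letters present, the maximum is a peak unless it is first or last. The two end
positions leave the same set of remaining words, so only the sum of the double weights enters. -/
theorem sum132_congr {c c' : Bool → Bool → ℤ} (h : SameTotals c c') (S : Finset ℕ) :
    sum132 c S = sum132 c' S := by
  induction hk : S.card using Nat.strong_induction_on generalizing S with
  | _ k ih =>
    rcases S.eq_empty_or_nonempty with rfl | hS
    · rw [sum132_empty, sum132_empty]
    have hm := S.max'_mem hS
    have hmax : ∀ y ∈ S, y ≤ S.max' hS := fun y hy => S.le_max' y hy
    set m := S.max' hS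
    have hlt : ∀ U ⊆ S.erase m, sum132 c U = sum132 c' U := by
      intro U hU
      refine ih U.card ?_ U rfl
      rw [← hk]
      exact (Finset.card_le_card hU).trans_lt (Finset.card_erase_lt_of_mem hm)
    rw [sum132_eq c hm hmax, sum132_eq c' hm hmax]
    rcases (S.erase m).eq_empty_or_nonempty with hT | hT
    · rw [hT]
      simp [sum132_empty, h.1]
    · rw [sum_powerset_eq hT, sum_powerset_eq hT]
      congr 1
      · simp only [Finset.notMem_empty, false_imp_iff, implies_true, if_true, Finset.sdiff_empty,
          Finset.sdiff_self, Finset.not_nonempty_empty, hT, decide_true, decide_false,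
          sum132_empty]
        rw [hlt _ subset_rfl]
        linear_combination sum132 c' (S.erase m) * h.2.2
      · refine Finset.sum_congr rfl fun U hU => ?_
        simp only [Finset.mem_erase, Finset.mem_powerset] at hU
        have h1 : U.Nonempty := Finset.nonempty_iff_ne_empty.2 hU.2.1
        have h2 : (S.erase m \ U).Nonempty := by
          rw [Finset.sdiff_nonempty]
          exact fun h' => hU.1 (hU.2.2.antisymm h')
        simp only [h1, h2, decide_true, hlt U hU.2.2, hlt _ Finset.sdiff_subset, h.2.1]

theorem pair_sublist_append {s t : List ℕ} {m m' : ℕ} (hn : (s ++ m :: t).Nodup) (hne : m' ≠ m) :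
    [m', m].Sublist (s ++ m :: t) ↔ m' ∈ s := by
  have hn' := hn
  rw [List.nodup_append', List.nodup_cons] at hn'
  constructor
  · intro h
    obtain ⟨l₁, l₂, e, h1, h2⟩ := List.sublist_append_iff.1 h
    rcases l₁ with _ | ⟨a, l₁⟩
    · simp only [List.nil_append] at e
      subst e
      rcases List.sublist_cons_iff.1 h2 with h3 | ⟨r, h3, -⟩
      · exact absurd (h3.subset (by simp)) hn'.2.1.1
      · simp only [List.cons.injEq] at h3
        exact absurd h3.1 hne
    · simp only [List.cons_append, List.cons.injEq] at e
      obtain ⟨rfl, -⟩ := e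
      exact h1.subset (by simp)
  · intro h
    exact (List.singleton_sublist.2 h).append ((List.nil_sublist t).cons_cons m)

theorem pair_sublist_append' {s t : List ℕ} {m m' : ℕ} (hn : (s ++ m :: t).Nodup)
    (hne : m' ≠ m) : [m, m'].Sublist (s ++ m :: t) ↔ m' ∈ t := by
  have h := pair_sublist_append (s := t.reverse) (t := s.reverse) (m := m) (m' := m')
    (by simpa using List.nodup_reverse.2 hn) hne
  rw [← List.reverse_sublist] at h
  simpa using h

/-- Words with `m'` after `m` are the mirror images of those with `m'` before `m`, and reversal
swaps the arguments of the weight. The end condition on the side of `m'` is automatic. -/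
theorem sumInner_eq {S : Finset ℕ} {m m' : ℕ} (hm : m ∈ S) (hm' : m' ∈ S) (hne : m' ≠ m) :
    sumInner c m S = sumLeft c m m' S + sumLeft (fun a b => c b a) m m' S := by
  classical
  have h2 : sumLeft (fun a b => c b a) m m' S = ∑ l ∈ words S,
      if AvoidsBoth l ∧ l.head? ≠ some m ∧ [m, m'].Sublist l then
        wordWeight c false l else 0 := by
    rw [sumLeft, ← sum_words_reverse]
    refine Finset.sum_congr rfl fun l hl => ?_
    rw [mem_words] at hl
    rw [wordWeight_reverse _ l hl.1, avoidsBoth_reverse, List.getLast?_reverse]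
    have : [m', m].Sublist l.reverse ↔ [m, m'].Sublist l := by
      rw [← List.reverse_sublist]
      simp
    simp only [this]
  rw [h2, sumInner, sumLeft, ← Finset.sum_add_distrib]
  refine Finset.sum_congr rfl fun l hl => ?_
  rw [mem_words] at hl
  obtain ⟨s, t, rfl⟩ := List.append_of_mem ((hl.2 m).2 hm)
  simp only [pair_sublist_append hl.1 hne, pair_sublist_append' hl.1 hne]
  have hmem := (hl.2 m').2 hm'
  have hn := hl.1
  rw [List.nodup_append', List.nodup_cons] at hn
  have hs : (s ++ m :: t).head? ≠ some m ↔ s ≠ [] := by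
    cases s with
    | nil => simp
    | cons x s =>
      have h3 : x ≠ m := by
        rintro rfl
        exact hn.2.2 (by simp : x ∈ x :: s) (by simp)
      simp [h3]
  have ht : (s ++ m :: t).getLast? ≠ some m ↔ t ≠ [] := by
    rcases List.eq_nil_or_concat t with rfl | ⟨t, x, rfl⟩
    · simp
    · have h3 : x ≠ m := by
        rintro rfl
        exact hn.2.1.1 (by simp)
      rw [show s ++ m :: t.concat x = (s ++ m :: t) ++ [x] by simp, List.getLast?_concat]
      simp [h3]
  simp only [hs, ht]
  rcases List.mem_append.1 hmem with h3 | h3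
  · have h4 : m' ∉ t := fun h4 => hn.2.2 h3 (by simp [h4])
    simp [h3, h4, List.ne_nil_of_mem h3]
  · have h4 : m' ∈ t := by
      rcases List.mem_cons.1 h3 with h4 | h4
      · exact absurd h4 hne
      · exact h4
    have h5 : m' ∉ s := fun h5 => hn.2.2 h5 h3
    simp [h4, h5, List.ne_nil_of_mem h4]

/-- Neither pattern begins or ends with its 4, so a maximum at an end of the word can be deleted
freely. -/
theorem sumBoth_eq {S : Finset ℕ} {m : ℕ} (hm : m ∈ S) (hmax : ∀ y ∈ S, y ≤ m)
    (hS : (S.erase m).Nonempty) :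
    sumBoth c S = (c false true + c true false) * sumBoth c (S.erase m) + sumInner c m S := by
  classical
  have hlt : ∀ y ∈ S.erase m, y < m := by
    intro y hy
    rw [Finset.mem_erase] at hy
    exact lt_of_le_of_ne (hmax y hy.2) hy.1
  have hhead : (∑ l ∈ words S, if l.head? = some m then
      (if AvoidsBoth l then wordWeight c false l else 0) else 0) =
      c false true * sumBoth c (S.erase m) := by
    rw [sum_words_head hm, sumBoth, Finset.mul_sum]
    refine Finset.sum_congr rfl fun r hr => ?_
    have hd := decide_ne_nil_of_mem_words hr
    rw [mem_words] at hr
    have h1 : ∀ y ∈ r, y < m := fun y hy => hlt y ((hr.2 y).1 hy)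
    rw [avoidsBoth_cons_max h1, wordWeight_cons c _ _ _ h1, hd]
    simp [hS]
  have hlast : (∑ l ∈ words S, if l.getLast? = some m then
      (if AvoidsBoth l then wordWeight c false l else 0) else 0) =
      c true false * sumBoth c (S.erase m) := by
    rw [← sum_words_reverse]
    simp only [List.getLast?_reverse]
    rw [sum_words_head hm (fun l => if AvoidsBoth l.reverse then
      wordWeight c false l.reverse else 0), sumBoth,
      ← sum_words_reverse (S.erase m) (fun l => if AvoidsBoth l then _ else _), Finset.mul_sum]
    refine Finset.sum_congr rfl fun r hr => ?_
    have hd := decide_ne_nil_of_mem_words hr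
    rw [mem_words] at hr
    have h1 : ∀ y ∈ r, y < m := fun y hy => hlt y ((hr.2 y).1 hy)
    rw [avoidsBoth_reverse, avoidsBoth_reverse, avoidsBoth_cons_max h1, List.reverse_cons,
      wordWeight_max c _ _ _ (by simpa using h1) (by simp)]
    have h2 : r ≠ [] := by simpa [hS] using hd
    simp [h2, wordWeight]
  rw [add_mul, ← hhead, ← hlast, sumBoth, sumInner, ← Finset.sum_add_distrib,
    ← Finset.sum_add_distrib]
  refine Finset.sum_congr rfl fun l hl => ?_
  have hnot : ¬ (l.head? = some m ∧ l.getLast? = some m) := by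
    rintro ⟨h1, h2⟩
    obtain ⟨y, hy⟩ := hS
    rw [mem_words] at hl
    rw [Finset.mem_erase] at hy
    have hyl := (hl.2 y).2 hy.2
    cases l with
    | nil => simp at h1
    | cons x l =>
      simp only [List.head?_cons, Option.some.injEq] at h1
      subst h1
      rcases List.eq_nil_or_concat l with rfl | ⟨l, z, rfl⟩
      · simp at hyl
        exact hy.1 hyl
      · rw [show x :: l.concat z = (x :: l) ++ [z] by simp, List.getLast?_concat] at h2
        have := hl.1
        simp at h2
        simp [h2] at this
  by_cases h1 : AvoidsBoth l <;> by_cases h2 : l.head? = some m <;>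
    by_cases h3 : l.getLast? = some m <;> simp_all

/-- In `a m' r` there are two cases. If `r` does not begin with `m`, then `m'` is followed by a
smaller letter and `m` is interior to `r`. If `r = m t`, then `m'` is followed by a larger letter
and `m` is a peak; here `t` is nonempty because `m` may not be last. -/
theorem sumLeft_eq {S : Finset ℕ} {m m' : ℕ} (hm' : m' ∈ S) (hlt : m' < m)
    (hmax : ∀ y ∈ S, y ≠ m → y ≤ m') :
    sumLeft c m m' S = ∑ U ∈ (S.erase m').powerset,
      if m ∈ S.erase m' \ U ∧ ∀ u ∈ U, ∀ x ∈ S.erase m' \ U, x ≠ m → x < u then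
        sum132 c U * (c (decide U.Nonempty) true * sumInner c m (S.erase m' \ U) +
          c (decide U.Nonempty) false * (c true true *
            if ((S.erase m' \ U).erase m).Nonempty then sumBoth c ((S.erase m' \ U).erase m)
            else 0)) else 0 := by
  classical
  rw [sumLeft, sum_words_pivot hm']
  refine Finset.sum_congr rfl fun U hU => ?_
  rw [Finset.mem_powerset] at hU
  by_cases h : m ∈ S.erase m' \ U ∧ ∀ u ∈ U, ∀ x ∈ S.erase m' \ U, x ≠ m → x < u
  · rw [if_pos h]
    obtain ⟨hmR, habove⟩ := h
    have hmU : m ∉ U := by simp at hmR; tauto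
    have hinner : ∀ f : List ℕ → ℤ, (∑ r ∈ words (S.erase m' \ U),
        if AvoidsBoth r ∧ r.getLast? ≠ some m then f r else 0) =
        (∑ r ∈ words (S.erase m' \ U),
          if AvoidsBoth r ∧ r.head? ≠ some m ∧ r.getLast? ≠ some m then f r else 0) +
        ∑ t ∈ words ((S.erase m' \ U).erase m),
          if AvoidsBoth t ∧ t ≠ [] then f (m :: t) else 0 := by
      intro f
      have h1 : (∑ t ∈ words ((S.erase m' \ U).erase m),
          if AvoidsBoth t ∧ t ≠ [] then f (m :: t) else 0) =
          ∑ r ∈ words (S.erase m' \ U), if r.head? = some m then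
            (if AvoidsBoth r ∧ r.getLast? ≠ some m then f r else 0) else 0 := by
        rw [sum_words_head hmR]
        refine Finset.sum_congr rfl fun t ht => ?_
        rw [mem_words] at ht
        have ht1 : ∀ y ∈ t, y < m := by
          intro y hy
          have h2 := (ht.2 y).1 hy
          simp only [Finset.mem_erase, Finset.mem_sdiff] at h2
          have := hmax y h2.2.1.2 h2.1
          omega
        have ht2 : (m :: t).getLast? ≠ some m ↔ t ≠ [] := by
          rcases List.eq_nil_or_concat t with rfl | ⟨t, x, rfl⟩
          · simp
          · have h3 : x ≠ m := (ht1 x (by simp)).ne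
            rw [show m :: t.concat x = (m :: t) ++ [x] by simp, List.getLast?_concat]
            simp [h3]
        simp only [avoidsBoth_cons_max ht1, ht2]
      rw [h1, ← Finset.sum_add_distrib]
      refine Finset.sum_congr rfl fun r _ => ?_
      by_cases h2 : r.head? = some m <;> simp [h2]
    have key : ∀ a ∈ words U, ∀ r ∈ words (S.erase m' \ U),
        (if AvoidsBoth (a ++ m' :: r) ∧ (a ++ m' :: r).getLast? ≠ some m ∧
          [m', m].Sublist (a ++ m' :: r) then wordWeight c false (a ++ m' :: r) else 0) =
        if Avoids132 a then (if AvoidsBoth r ∧ r.getLast? ≠ some m then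
          wordWeight c false (a ++ m' :: r) else 0) else 0 := by
      intro a ha r hr
      have hn := nodup_append_of_mem_words ha hU hr
      rw [mem_words] at ha hr
      have hmr : m ∈ r := (hr.2 m).2 hmR
      have h1 : [m', m].Sublist (a ++ m' :: r) :=
        ((List.singleton_sublist.2 hmr).cons_cons m').trans (List.sublist_append_right _ _)
      have h2 : (a ++ m' :: r).getLast? = r.getLast? := by
        rcases List.eq_nil_or_concat r with rfl | ⟨r, x, rfl⟩
        · simp at hmr
        · rw [show a ++ m' :: r.concat x = (a ++ m' :: r) ++ [x] by simp, List.getLast?_concat]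
          simp
      rw [h2]
      by_cases h3 : r.getLast? = some m
      · simp [h3]
      · have h4 := avoidsBoth_append_second_max hn hlt hmr h3 (by
          intro y hy
          have h5 := hU ((ha.2 y).1 hy)
          rw [Finset.mem_erase] at h5
          refine lt_of_le_of_ne (hmax y h5.2 ?_) h5.1
          rintro rfl
          exact hmU ((ha.2 y).1 hy)) (by
          intro y hy hym
          have h5 := (hr.2 y).1 hy
          rw [Finset.mem_sdiff, Finset.mem_erase] at h5
          exact lt_of_le_of_ne (hmax y h5.1.2 hym) h5.1.1)
        simp only [ha.2, hr.2] at h4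
        rw [and_iff_right habove] at h4
        by_cases h5 : Avoids132 a <;> by_cases h6 : AvoidsBoth r <;> simp [h1, h3, h4, h5, h6]
    rw [sum132, Finset.sum_mul]
    refine Finset.sum_congr rfl fun a ha => ?_
    rw [Finset.sum_congr rfl (key a ha)]
    by_cases h132 : Avoids132 a
    swap
    · simp [h132]
    simp only [if_pos h132]
    rw [hinner, mul_add]
    have hda := decide_ne_nil_of_mem_words ha
    rw [mem_words] at ha
    have ham : ∀ y ∈ a, y < m' := by
      intro y hy
      have h5 := hU ((ha.2 y).1 hy)
      rw [Finset.mem_erase] at h5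
      refine lt_of_le_of_ne (hmax y h5.2 ?_) h5.1
      rintro rfl
      exact hmU ((ha.2 y).1 hy)
    have hlt2 : ∀ y ∈ S.erase m' \ U, y ≠ m → y < m' := by
      intro y hy hym
      rw [Finset.mem_sdiff, Finset.mem_erase] at hy
      exact lt_of_le_of_ne (hmax y hy.1.2 hym) hy.1.1
    congr 1
    · rw [sumInner, Finset.mul_sum, Finset.mul_sum]
      refine Finset.sum_congr rfl fun r hr => ?_
      rw [mem_words] at hr
      split_ifs with h6
      swap
      · simp
      obtain ⟨b, t, rfl⟩ := List.append_of_mem ((hr.2 m).2 hmR)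
      -- Since `b` is nonempty, `m` has a smaller left neighbour already within `r`, so putting `a
      -- m'` in front does not change its weight.
      have hb : b ≠ [] := by
        rintro rfl
        simp at h6
      have hn := hr.1
      rw [List.nodup_append', List.nodup_cons] at hn
      have hbm : ∀ y ∈ b, y < m' := by
        intro y hy
        refine hlt2 y ((hr.2 y).1 (by simp [hy])) ?_
        rintro rfl
        exact hn.2.2 hy (by simp)
      have htm : ∀ y ∈ t, y < m' := by
        intro y hy
        refine hlt2 y ((hr.2 y).1 (by simp [hy])) ?_
        rintro rfl
        exact hn.2.1.1 hy
      rw [show a ++ m' :: (b ++ m :: t) = (a ++ m' :: b) ++ m :: t by simp,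
        wordWeight_max c (a ++ m' :: b) t m, wordWeight_max c a b m' ham hbm,
        wordWeight_max c b t m, hda]
      · simp [hb]
        ring
      · exact fun y hy => (hbm y hy).trans hlt
      · exact fun y hy => (htm y hy).trans hlt
      · intro y hy
        simp only [List.mem_append, List.mem_cons] at hy
        rcases hy with hy | rfl | hy
        · exact (ham y hy).trans hlt
        · exact hlt
        · exact (hbm y hy).trans hlt
      · exact fun y hy => (htm y hy).trans hlt
    · split_ifs with hne
      · rw [sumBoth, Finset.mul_sum, Finset.mul_sum, Finset.mul_sum]
        refine Finset.sum_congr rfl fun t ht => ?_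
        have hdt := decide_ne_nil_of_mem_words ht
        have ht0 : t ≠ [] := by simpa [hne] using hdt
        rw [mem_words] at ht
        split_ifs with h6 h7
        · rw [show a ++ m' :: m :: t = (a ++ [m']) ++ m :: t by simp,
            wordWeight_max c (a ++ [m']) t m, wordWeight_max c a [] m' ham (by simp), hda]
          · simp [ht0, wordWeight]
            ring
          · intro y hy
            simp only [List.mem_append, List.mem_singleton] at hy
            rcases hy with hy | rfl
            · exact (ham y hy).trans hlt
            · exact hlt
          · intro y hy
            have h8 := (ht.2 y).1 hy
            rw [Finset.mem_erase] at h8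
            exact (hlt2 y h8.2 h8.1).trans hlt
        · exact absurd h6.1 h7
        · exact absurd ⟨by assumption, ht0⟩ h6
        · simp
      · rw [Finset.not_nonempty_iff_eq_empty.1 hne, words_empty]
        simp
  · rw [if_neg h]
    refine Finset.sum_eq_zero fun a ha => Finset.sum_eq_zero fun r hr => ?_
    rw [if_neg]
    rintro ⟨h1, h2, h3⟩
    apply h
    have hn := nodup_append_of_mem_words ha hU hr
    rw [mem_words] at ha hr
    have hn' := hn
    rw [List.nodup_append', List.nodup_cons] at hn'
    have hmr : m ∈ r := by
      have h4 := (pair_sublist_append' hn hlt.ne').1 h3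
      exact h4
    have hmR := (hr.2 m).1 hmr
    have hmU : m ∉ U := (Finset.mem_sdiff.1 hmR).2
    have h2' : r.getLast? ≠ some m := by
      rcases List.eq_nil_or_concat r with rfl | ⟨r, x, rfl⟩
      · simp at hmr
      · rw [show a ++ m' :: r.concat x = (a ++ m' :: r) ++ [x] by simp,
          List.getLast?_concat] at h2
        simpa using h2
    have h4 := (avoidsBoth_append_second_max hn hlt hmr h2' (by
      intro y hy
      have h5 := hU ((ha.2 y).1 hy)
      rw [Finset.mem_erase] at h5
      refine lt_of_le_of_ne (hmax y h5.2 ?_) h5.1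
      rintro rfl
      exact hmU ((ha.2 y).1 hy)) (by
      intro y hy hym
      have h5 := (hr.2 y).1 hy
      rw [Finset.mem_sdiff, Finset.mem_erase] at h5
      exact lt_of_le_of_ne (hmax y h5.1.2 hym) h5.1.1)).1 h1
    refine ⟨hmR, fun u hu x hx hxm => ?_⟩
    exact h4.1 u ((ha.2 u).2 hu) x ((hr.2 x).2 hx) hxm

theorem sumInner_singleton (m : ℕ) : sumInner c m {m} = 0 := by
  refine Finset.sum_eq_zero fun l hl => ?_
  rw [if_neg]
  rintro ⟨-, h, -⟩
  rw [mem_words] at hl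
  cases l with
  | nil => simpa using hl.2 m
  | cons x l =>
    have := (hl.2 x).1 (by simp)
    simp at this
    simp [this] at h

theorem sumBoth_singleton (m : ℕ) : sumBoth c {m} = c false false := by
  have : words {m} = {[m]} := by
    ext l
    rw [mem_words, Finset.mem_singleton]
    constructor
    · rintro ⟨h1, h2⟩
      rw [← List.perm_singleton, List.perm_ext_iff_of_nodup h1 (by simp)]
      simpa using h2
    · rintro rfl
      simp
  rw [sumBoth, this, Finset.sum_singleton, if_pos]
  · simp [wordWeight]
  · intro x y z t h
    simpa using h.length_le

/-- The induction lets the weights vary, because the recursion for interior `m` also uses the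
swapped weights. -/
theorem sums_congr {c c' : Bool → Bool → ℤ} (h : SameTotals c c') {S : Finset ℕ} {m : ℕ}
    (hm : m ∈ S) (hmax : ∀ y ∈ S, y ≤ m) :
    sumBoth c S = sumBoth c' S ∧ sumInner c m S = sumInner c' m S := by
  induction hk : S.card using Nat.strong_induction_on generalizing S m c c' with
  | _ k ih =>
    subst hk
    rcases (S.erase m).eq_empty_or_nonempty with hT | hT
    · obtain rfl : S = {m} := by
        rw [← Finset.insert_erase hm, hT]
        rfl
      simp [sumInner_singleton, sumBoth_singleton, h.1]
    have hboth : ∀ {d d' : Bool → Bool → ℤ}, SameTotals d d' → ∀ V : Finset ℕ, V.Nonempty →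
        V ⊂ S → sumBoth d V = sumBoth d' V := fun hd V hV hVS =>
      (ih V.card (Finset.card_lt_card hVS) hd (V.max'_mem hV) (fun y hy => V.le_max' y hy) rfl).1
    have hinner : ∀ {d d' : Bool → Bool → ℤ}, SameTotals d d' → ∀ V : Finset ℕ, m ∈ V →
        V ⊂ S → sumInner d m V = sumInner d' m V := fun hd V hV hVS =>
      (ih V.card (Finset.card_lt_card hVS) hd hV (fun y hy => hmax y (hVS.subset hy)) rfl).2
    have hI : sumInner c m S = sumInner c' m S := by
      have hm' := (S.erase m).max'_mem hT
      have hmax' : ∀ y ∈ S, y ≠ m → y ≤ (S.erase m).max' hT :=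
        fun y hy hym => (S.erase m).le_max' y (Finset.mem_erase.2 ⟨hym, hy⟩)
      set m' := (S.erase m).max' hT
      rw [Finset.mem_erase] at hm'
      have hlt : m' < m := lt_of_le_of_ne (hmax m' hm'.2) hm'.1
      rw [sumInner_eq c hm hm'.2 hm'.1, sumInner_eq c' hm hm'.2 hm'.1]
      simp only [sumLeft_eq _ hm'.2 hlt hmax', ← Finset.sum_add_distrib]
      refine Finset.sum_congr rfl fun U hU => ?_
      split_ifs with h1 h2
      all_goals try rfl
      all_goals
        have hR : S.erase m' \ U ⊂ S :=
          Finset.sdiff_subset.trans_ssubset (Finset.erase_ssubset hm'.2)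
        -- By induction the smaller sums agree for all four weights `c`, `c'` and their swaps; only
        -- the weights of `m'` and `m` remain to be compared.
        rw [← sum132_congr (SameTotals.swap c), ← sum132_congr (SameTotals.swap c'),
          ← sum132_congr h, ← hinner (SameTotals.swap c) _ h1.1 hR,
          ← hinner (SameTotals.swap c') _ h1.1 hR, ← hinner h _ h1.1 hR]
      · have hB : (S.erase m' \ U).erase m ⊂ S :=
          (Finset.erase_subset _ _).trans_ssubset hR
        rw [← hboth (SameTotals.swap c) _ h2 hB, ← hboth (SameTotals.swap c') _ h2 hB,
          ← hboth h _ h2 hB, ← h.2.1]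
        obtain ⟨e1, e2, e3⟩ := h
        -- For nonempty `U`, `m'` is a peak, or a double letter when `m` follows it directly. For
        -- empty `U` it is a double letter, or a valley when `m` follows it directly. The double
        -- cases of a word and its mirror image add up to `e3`.
        by_cases hUn : U.Nonempty
        · simp only [hUn, decide_true, ← e2]
          linear_combination sum132 c U * c true true * sumBoth c ((S.erase m' \ U).erase m) * e3
        · simp only [hUn, decide_false, ← e1]
          linear_combination sum132 c U * sumInner c m (S.erase m' \ U) * e3
      · obtain ⟨e1, e2, e3⟩ := h
        by_cases hUn : U.Nonempty
        · simp only [hUn, decide_true, ← e2]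
          ring
        · simp only [hUn, decide_false]
          linear_combination sum132 c U * sumInner c m (S.erase m' \ U) * e3
    refine ⟨?_, hI⟩
    rw [sumBoth_eq c hm hmax hT, sumBoth_eq c' hm hmax hT, hI, h.2.2,
      hboth h _ hT (Finset.erase_ssubset hm)]

end WeightedSums

/-! ### From permutations to words, and the two special weights -/

section Permutations

/-- The word `π(1) π(2) ⋯ π(n)`. -/
def letters {n : ℕ} (π : Equiv.Perm (Fin n)) : List ℕ := List.ofFn fun i => (π i : ℕ)

theorem quadruple_sublist_ofFn {n : ℕ} (g : Fin n → ℕ) (x y z w : ℕ) :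
    [x, y, z, w].Sublist (List.ofFn g) ↔
      ∃ i j k l, i < j ∧ j < k ∧ k < l ∧ g i = x ∧ g j = y ∧ g k = z ∧ g l = w := by
  rw [List.sublist_iff_exists_fin_orderEmbedding_get_eq]
  constructor
  · rintro ⟨f, hf⟩
    refine ⟨(f 0).cast List.length_ofFn, (f 1).cast List.length_ofFn,
      (f 2).cast List.length_ofFn, (f 3).cast List.length_ofFn, ?_, ?_, ?_, ?_, ?_, ?_, ?_⟩
    · exact f.strictMono (show (0 : Fin 4) < 1 by decide)
    · exact f.strictMono (show (1 : Fin 4) < 2 by decide)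
    · exact f.strictMono (show (2 : Fin 4) < 3 by decide)
    · have h := (hf (0 : Fin 4)).symm
      rw [List.get_ofFn] at h
      exact h
    · have h := (hf (1 : Fin 4)).symm
      rw [List.get_ofFn] at h
      exact h
    · have h := (hf (2 : Fin 4)).symm
      rw [List.get_ofFn] at h
      exact h
    · have h := (hf (3 : Fin 4)).symm
      rw [List.get_ofFn] at h
      exact h
  · rintro ⟨i, j, k, l, h1, h2, h3, rfl, rfl, rfl, rfl⟩
    have hm : StrictMono (fun a : Fin 4 =>
        (![i, j, k, l] a).cast (List.length_ofFn (f := g)).symm) := by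
      rw [Fin.strictMono_iff_lt_succ]
      intro a
      fin_cases a
      · exact h1
      · exact h2
      · exact h3
    refine ⟨OrderEmbedding.ofStrictMono _ hm, ?_⟩
    intro a
    change Fin 4 at a
    fin_cases a <;> simp

theorem contains_p1342 {n : ℕ} (π : Equiv.Perm (Fin n)) :
    Contains p1342 π ↔
      ∃ i j k l, i < j ∧ j < k ∧ k < l ∧ π i < π l ∧ π l < π j ∧ π j < π k := by
  constructor
  · rintro ⟨f, hf, h⟩
    exact ⟨f 0, f 1, f 2, f 3, hf (by decide), hf (by decide), hf (by decide),
      (h 0 3).1 (by decide), (h 3 1).1 (by decide), (h 1 2).1 (by decide)⟩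
  · rintro ⟨i, j, k, l, h1, h2, h3, h4, h5, h6⟩
    refine ⟨![i, j, k, l], ?_, ?_⟩
    · rw [Fin.strictMono_iff_lt_succ]
      intro a
      fin_cases a
      · exact h1
      · exact h2
      · exact h3
    · intro a b
      fin_cases a <;> fin_cases b <;> simp [p1342] <;> omega

theorem contains_p2431 {n : ℕ} (π : Equiv.Perm (Fin n)) :
    Contains p2431 π ↔
      ∃ i j k l, i < j ∧ j < k ∧ k < l ∧ π l < π i ∧ π i < π k ∧ π k < π j := by
  constructor
  · rintro ⟨f, hf, h⟩
    exact ⟨f 0, f 1, f 2, f 3, hf (by decide), hf (by decide), hf (by decide),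
      (h 3 0).1 (by decide), (h 0 2).1 (by decide), (h 2 1).1 (by decide)⟩
  · rintro ⟨i, j, k, l, h1, h2, h3, h4, h5, h6⟩
    refine ⟨![i, j, k, l], ?_, ?_⟩
    · rw [Fin.strictMono_iff_lt_succ]
      intro a
      fin_cases a
      · exact h1
      · exact h2
      · exact h3
    · intro a b
      fin_cases a <;> fin_cases b <;> simp [p2431] <;> omega

theorem mem_avoiders_iff {n : ℕ} (π : Equiv.Perm (Fin n)) :
    π ∈ avoiders n p1342 p2431 ↔ AvoidsBoth (letters π) := by
  simp only [avoiders, Finset.mem_filter, Finset.mem_univ, true_and, contains_p1342,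
    contains_p2431, AvoidsBoth, letters, quadruple_sublist_ofFn]
  constructor
  · rintro ⟨h1, h2⟩ x y z w ⟨i, j, k, l, hij, hjk, hkl, rfl, rfl, rfl, rfl⟩
    exact ⟨fun h => h1 ⟨i, j, k, l, hij, hjk, hkl, h.1, h.2.1, h.2.2⟩,
      fun h => h2 ⟨i, j, k, l, hij, hjk, hkl, h.1, h.2.1, h.2.2⟩⟩
  · intro h
    constructor
    · rintro ⟨i, j, k, l, hij, hjk, hkl, h'⟩
      exact (h _ _ _ _ ⟨i, j, k, l, hij, hjk, hkl, rfl, rfl, rfl, rfl⟩).1 h'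
    · rintro ⟨i, j, k, l, hij, hjk, hkl, h'⟩
      exact (h _ _ _ _ ⟨i, j, k, l, hij, hjk, hkl, rfl, rfl, rfl, rfl⟩).2 h'

theorem letters_injective {n : ℕ} : Function.Injective (letters (n := n)) := by
  intro π π' h
  have h1 := List.ofFn_injective h
  ext i
  exact congrFun h1 i

theorem letters_mem_words {n : ℕ} (π : Equiv.Perm (Fin n)) : letters π ∈ words (range n) := by
  rw [mem_words]
  constructor
  · rw [letters, List.nodup_ofFn]
    exact Fin.val_injective.comp π.injective
  · intro y
    rw [letters, List.mem_ofFn, Finset.mem_range]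
    constructor
    · rintro ⟨i, rfl⟩
      exact (π i).2
    · intro hy
      exact ⟨π.symm ⟨y, hy⟩, by simp⟩

theorem exists_letters_eq {n : ℕ} {l : List ℕ} (hl : l ∈ words (range n)) :
    ∃ π : Equiv.Perm (Fin n), letters π = l := by
  rw [mem_words] at hl
  have hlen : l.length = n := by
    rw [← List.toFinset_card_of_nodup hl.1]
    have : l.toFinset = range n := by
      ext y
      rw [List.mem_toFinset, hl.2]
    rw [this, Finset.card_range]
  subst hlen
  let f : Fin l.length → Fin l.length := fun i =>
    ⟨l.get i, Finset.mem_range.1 ((hl.2 _).1 (List.get_mem l i))⟩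
  have hf : Function.Injective f := by
    intro i j h
    exact List.nodup_iff_injective_get.1 hl.1 (Fin.mk.inj_iff.1 h)
  refine ⟨Equiv.ofBijective f (Finite.injective_iff_bijective.1 hf), ?_⟩
  exact List.ofFn_get l

open Classical in
theorem sum_avoiders_eq (n : ℕ) (f : List ℕ → ℤ) :
    ∑ π ∈ avoiders n p1342 p2431, f (letters π) =
      ∑ l ∈ words (range n), if AvoidsBoth l then f l else 0 := by
  rw [← Finset.sum_filter]
  refine Finset.sum_nbij letters ?_ letters_injective.injOn ?_ (fun _ _ => rfl)
  · intro π hπ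
    rw [Finset.mem_filter]
    exact ⟨letters_mem_words π, (mem_avoiders_iff π).1 hπ⟩
  · intro l hl
    rw [Finset.mem_coe, Finset.mem_filter] at hl
    obtain ⟨π, rfl⟩ := exists_letters_eq hl.1
    exact ⟨π, (mem_avoiders_iff π).2 hl.2, rfl⟩

/-- A letter weighs `-1` if it is followed by a smaller one. -/
def descentWeight : Bool → Bool → ℤ := fun _ r => if r then -1 else 1

/-- Valleys weigh `1`, peaks weigh `-1`, and words with other letters do not count. -/
def alternatingWeight : Bool → Bool → ℤ := fun l r => if l = r then (if r then -1 else 1) else 0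

theorem sameTotals_descent_alternating : SameTotals descentWeight alternatingWeight := by
  simp [SameTotals, descentWeight, alternatingWeight]

theorem wordWeight_descentWeight (n : ℕ) (g : ℕ → ℕ) (b : Bool) :
    wordWeight descentWeight b (List.ofFn fun i : Fin n => g i) =
      ∏ i : Fin n, if (i : ℕ) + 1 < n ∧ g (i + 1) < g i then (-1 : ℤ) else 1 := by
  induction n generalizing g b with
  | zero => simp [wordWeight]
  | succ n ih =>
    cases n with
    | zero => simp [wordWeight, descentWeight]
    | succ n =>
      have := ih (fun i => g (i + 1)) (decide (g 0 < g 1))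
      rw [Fin.prod_univ_succ, List.ofFn_succ, List.ofFn_succ]
      rw [List.ofFn_succ] at this
      simp only [Fin.val_zero, Fin.val_succ, zero_add] at this ⊢
      rw [wordWeight, this]
      simp [descentWeight]

-- The last letter has no right neighbour, so it must be a valley, while `b` decides whether the
-- first is a valley or a peak; this fixes the parity of the length. In both cases `(n + 1) / 2` is
-- the number of peaks.
open Classical in
theorem wordWeight_alternatingWeight (n : ℕ) (g : ℕ → ℕ) (b : Bool)
    (hg : ∀ i, i + 1 < n + 1 → g i ≠ g (i + 1)) :
    wordWeight alternatingWeight b (List.ofFn fun i : Fin (n + 1) => g i) =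
      if (Even n ↔ b = false) ∧
          ∀ i, i + 1 < n + 1 → (g i < g (i + 1) ↔ (Even i ↔ b = false)) then
        (-1 : ℤ) ^ ((n + 1) / 2) else 0 := by
  induction n generalizing g b with
  | zero => cases b <;> simp [wordWeight, alternatingWeight]
  | succ n ih =>
    have := ih (fun i => g (i + 1)) (decide (g 0 < g 1)) (fun i hi => hg (i + 1) (by omega))
    rw [List.ofFn_succ, List.ofFn_succ]
    rw [List.ofFn_succ] at this
    simp only [Fin.val_zero, Fin.val_succ, zero_add] at this ⊢
    rw [wordWeight, this]
    have h0 := hg 0 (by omega)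
    simp only [zero_add] at h0
    by_cases hb : decide (g 1 < g 0) = b
    · have hb' : decide (g 0 < g 1) = !b := by
        rw [← hb]
        by_cases h : g 1 < g 0
        · simp [h, h.le]
        · have : g 0 < g 1 := by omega
          simp [this, this.le]
      have hiff : ((Even n ↔ decide (g 0 < g 1) = false) ∧ ∀ i, i + 1 < n + 1 →
          (g (i + 1) < g (i + 1 + 1) ↔ (Even i ↔ decide (g 0 < g 1) = false))) ↔
          ((Even (n + 1) ↔ b = false) ∧ ∀ i, i + 1 < n + 1 + 1 →
          (g i < g (i + 1) ↔ (Even i ↔ b = false))) := by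
        rw [hb']
        have hb2 : g 0 < g 1 ↔ b = false := by
          rw [← decide_eq_true_iff (p := g 0 < g 1), hb']
          simp
        refine and_congr ?_ ⟨fun h i hi => ?_, fun h i hi => ?_⟩
        · rw [Nat.even_add_one]
          cases b <;> simp
        · cases i with
          | zero => simpa using hb2
          | succ i =>
            rw [h i (by omega), Nat.even_add_one]
            cases b <;> simp
        · rw [h (i + 1) (by omega), Nat.even_add_one]
          cases b <;> simp
      simp only [hiff]
      split_ifs with h
      · have he := h.1
        rw [hb]
        cases b with
        | false =>
          have h2 : Even (n + 1) := by simpa using he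
          obtain ⟨k, hk⟩ := h2
          rw [show (n + 1 + 1) / 2 = (n + 1) / 2 by omega]
          simp [alternatingWeight]
        | true =>
          have h2 : ¬ Even (n + 1) := by simpa using he
          rw [Nat.not_even_iff_odd] at h2
          obtain ⟨k, hk⟩ := h2
          rw [show (n + 1 + 1) / 2 = (n + 1) / 2 + 1 by omega]
          simp [alternatingWeight, pow_succ]
      · simp
    · have hw : alternatingWeight b (decide (g 1 < g 0)) = 0 := by
        simp [alternatingWeight, Ne.symm hb]
      rw [hw, zero_mul, if_neg]
      · rintro ⟨-, h⟩
        have h1 := h 0 (by omega)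
        simp only [zero_add, Even.zero, true_iff] at h1
        apply hb
        cases b with
        | false =>
          have := h1.2 rfl
          simp [this.le]
        | true =>
          have : ¬ g 0 < g 1 := by simp [h1]
          have : g 1 < g 0 := by omega
          simp [this]

/-- A function on all of `ℕ` can be shifted, as the inductions on word weights require; its values
from `n` on are irrelevant. -/
theorem exists_extension {n : ℕ} (π : Equiv.Perm (Fin n)) :
    ∃ g : ℕ → ℕ, ∀ i : Fin n, g i = π i :=
  ⟨fun i => if h : i < n then π ⟨i, h⟩ else 0, fun i => by simp⟩

theorem wordWeight_letters_descentWeight {n : ℕ} (π : Equiv.Perm (Fin n)) :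
    wordWeight descentWeight false (letters π) = (-1) ^ des π := by
  obtain ⟨g, hg⟩ := exists_extension π
  have h1 : letters π = List.ofFn fun i : Fin n => g i := by simp only [letters, hg]
  rw [h1, wordWeight_descentWeight, des, Finset.prod_ite, Finset.prod_const, Finset.prod_const_one,
    mul_one]
  congr 2
  ext i
  simp only [Finset.mem_filter, Finset.mem_univ, true_and]
  constructor
  · rintro ⟨h, h'⟩
    refine ⟨h, ?_⟩
    have h2 := hg ⟨i + 1, h⟩
    simp only at h2
    rw [Fin.lt_def, ← h2, ← hg]
    exact h'
  · rintro ⟨h, h'⟩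
    refine ⟨h, ?_⟩
    have h2 := hg ⟨i + 1, h⟩
    simp only at h2
    rw [Fin.lt_def, ← h2, ← hg] at h'
    exact h'

theorem wordWeight_letters_alternatingWeight {n : ℕ} (hn : 1 ≤ n) (π : Equiv.Perm (Fin n)) :
    wordWeight alternatingWeight false (letters π) =
      if Odd n ∧ IsAlternating π then (-1) ^ (n / 2) else 0 := by
  obtain ⟨n, rfl⟩ : ∃ k, n = k + 1 := ⟨n - 1, by omega⟩
  obtain ⟨g, hg⟩ := exists_extension π
  have h1 : letters π = List.ofFn fun i : Fin (n + 1) => g i := by simp only [letters, hg]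
  have hg' : ∀ i (h : i < n + 1), g i = π ⟨i, h⟩ := fun i h => hg ⟨i, h⟩
  have hne : ∀ i, i + 1 < n + 1 → g i ≠ g (i + 1) := by
    intro i hi
    rw [hg' i (by omega), hg' (i + 1) hi]
    intro h
    have := π.injective (Fin.val_injective h)
    simp at this
  have hiff : ((Even n ↔ false = false) ∧
      ∀ i, i + 1 < n + 1 → (g i < g (i + 1) ↔ (Even i ↔ false = false))) ↔
      Odd (n + 1) ∧ IsAlternating π := by
    refine and_congr ?_ ?_
    · rw [← Nat.not_even_iff_odd, Nat.even_add_one]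
      simp
    · simp only [iff_true]
      constructor
      · intro h i hi
        have h2 := h i hi
        have h3 := hne i hi
        rw [hg' i i.2, hg' (i + 1) hi] at h2 h3
        simp only [Fin.lt_def]
        constructor
        · exact fun he => h2.2 he
        · intro ho
          rw [← Nat.not_even_iff_odd, ← h2] at ho
          simp only [Fin.eta] at ho h3
          omega
      · intro h i hi
        have h2 := h ⟨i, by omega⟩ hi
        rw [hg' i (by omega), hg' (i + 1) hi]
        simp only [Fin.lt_def] at h2
        constructor
        · intro h3
          by_contra h4
          have := h2.2 (Nat.not_even_iff_odd.1 h4)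
          omega
        · exact fun h3 => h2.1 h3
  rw [h1, wordWeight_alternatingWeight n g false hne]
  by_cases h : Odd (n + 1) ∧ IsAlternating π
  · rw [if_pos h, if_pos (hiff.2 h)]
  · rw [if_neg h, if_neg (fun h' => h (hiff.1 h'))]

theorem sum_neg_one_pow_des {n : ℕ} (hn : 1 ≤ n) :
    ∑ π ∈ avoiders n p1342 p2431, (-1 : ℤ) ^ des π =
      ∑ π ∈ avoiders n p1342 p2431, if Odd n ∧ IsAlternating π then (-1) ^ (n / 2) else 0 := by
  simp only [← wordWeight_letters_descentWeight, ← wordWeight_letters_alternatingWeight hn]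
  rw [sum_avoiders_eq n (wordWeight descentWeight false),
    sum_avoiders_eq n (wordWeight alternatingWeight false)]
  refine (sums_congr sameTotals_descent_alternating (S := range n) (m := n - 1) ?_ ?_).1
  · rw [Finset.mem_range]
    omega
  · intro y hy
    rw [Finset.mem_range] at hy
    omega

end Permutations

end PatternAvoidance

theorem mainTheorem12 (n : ℕ) (hn : 1 ≤ n) :
    (PatternAvoidance.Y n).eval (-1) =
        ∑ π ∈ PatternAvoidance.avoiders n PatternAvoidance.p1342 PatternAvoidance.p2431,
          (-1 : ℤ) ^ PatternAvoidance.des π ∧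
      (Even n → (PatternAvoidance.Y n).eval (-1) = 0) ∧
      (Odd n → (PatternAvoidance.Y n).eval (-1) =
        (-1) ^ ((n - 1) / 2) * (PatternAvoidance.u ((n - 1) / 2) : ℤ)) := by
  have hY : (PatternAvoidance.Y n).eval (-1) =
      ∑ π ∈ PatternAvoidance.avoiders n PatternAvoidance.p1342 PatternAvoidance.p2431,
        (-1 : ℤ) ^ PatternAvoidance.des π := by
    simp [PatternAvoidance.Y, Polynomial.eval_finsetSum]
  refine ⟨hY, fun he => ?_, fun ho => ?_⟩
  · rw [hY, PatternAvoidance.sum_neg_one_pow_des hn]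
    simp [Nat.not_odd_iff_even.2 he]
  · rw [hY, PatternAvoidance.sum_neg_one_pow_des hn]
    obtain ⟨k, rfl⟩ := ho
    have h1 : (2 * k + 1 - 1) / 2 = k := by omega
    have h2 : (2 * k + 1) / 2 = k := by omega
    rw [h1, h2, ← Finset.sum_filter, Finset.sum_const, PatternAvoidance.u,
      PatternAvoidance.alternatingAvoiders]
    simp [mul_comm]
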